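/- Let $a<0<b$, let $h$ be real analytic on a neighbourhood of $[a,b]$ with $h(0)=0$, $h'(0)>0$ and $xh(x)>0$ for all $x\in[a,b]$, $x\neq0$, let $H(x)=\int_0^x h(t)\,dt$, and suppose that $H(a)=H(b)$. (So $0$ is a center of the potential equation (8).) Then there is exactly one map $A:[a,b]\to[a,b]$ with $H(A(x))=H(x)$ for all $x\in[a,b]$ and $A(x)x<0$ for all $x\in[a,b]$, $x\ne0$. It is an analytic involution with $A(0)=0$ and $A'<0$, the potential $H$ is $A$-invariant, and under the change of variable $x=A(y)$ the equation $$\ddot x+h(x)=0\qquad(8)$$ is equivalent to the Langmuir-type equation $$A''(y)\,\dot y^2+A'(y)\,\ddot y+h(A(y))=0,\qquad(8')$$ that is, a function $y$ from an open set of times to $[a,b]$ solves $(8')$ if and only if $x=A(y)$ solves $(8)$. Call $0$ an isochronous center of one of these equations if all points $(x,\dot x)\neq(0,0)$ of some neighbourhood of the origin in the phase plane lie on closed orbits with one and the same minimal period. Consider the conditions: 1. $0$ is an isochronous center of $(8)$; 2. $0$ is an isochronous center of $(8')$; 3. $h(x)=\frac14\,(x-A(x))\,(1-A'(x))$ for all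 $x\in[a,b]$; 4. $A(x)=x-2\,\operatorname{sgn}(x)\sqrt{2H(x)}$ for all $x\in[a,b]$. Then 1 and 2 are equivalent, 3 and 4 are equivalent, and 3 implies 1. If moreover $h'(0)=1$, then all four conditions are equivalent. -/

import Mathlib

open Set Filter Topology

/-- The potential `H(x) = ∫₀ˣ h(t) dt`. -/
noncomputable def potential (h : ℝ → ℝ) (x : ℝ) : ℝ := ∫ t in (0 : ℝ)..x, h t

/-- `A` is the involution of `[a, b]` attached to the potential of `h`: it maps `[a, b]` to itself,
preserves the potential, and moves every nonzero point to the other side of `0`.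
(No regularity and no involution property is required; values outside `[a, b]` are irrelevant.) -/
structure IsEnergyInvolution (h : ℝ → ℝ) (a b : ℝ) (A : ℝ → ℝ) : Prop where
  mapsTo : MapsTo A (Icc a b) (Icc a b)
  potential_eq : ∀ x ∈ Icc a b, potential h (A x) = potential h x
  mul_neg : ∀ x ∈ Icc a b, x ≠ 0 → A x * x < 0

/-- A (possibly implicit) autonomous second order equation `E(x, x', x'') = 0` is given by
`E : ℝ → ℝ → ℝ → ℝ`. The pair `(x, v)` is a solution in the phase plane on the set of times `J`,
with `x` staying in `S`, if `x' = v` and `E(x, v, v') = 0` on `J`. -/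
def SolvesOn (E : ℝ → ℝ → ℝ → ℝ) (S J : Set ℝ) (x v : ℝ → ℝ) : Prop :=
  ∀ t ∈ J, x t ∈ S ∧ HasDerivAt x (v t) t ∧ ∃ w : ℝ, HasDerivAt v w t ∧ E (x t) (v t) w = 0

/-- The potential equation `x'' + h(x) = 0`. -/
def potentialEq (h : ℝ → ℝ) : ℝ → ℝ → ℝ → ℝ :=
  fun x _ w => w + h x

/-- The equation `A''(y) y'^2 + A'(y) y'' + h(A(y)) = 0`, where the derivatives of `A` are taken
within the interval `[a, b]` on which `A` is given (they are one-sided at `a` and `b`). -/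
noncomputable def transformedEq (h A : ℝ → ℝ) (a b : ℝ) : ℝ → ℝ → ℝ → ℝ :=
  fun y v w =>
    derivWithin (fun z => derivWithin A (Icc a b) z) (Icc a b) y * v ^ 2
      + derivWithin A (Icc a b) y * w + h (A y)

/-- `T` is the minimal positive period of the curve `t ↦ (x t, v t)`. -/
def HasMinimalPeriod (x v : ℝ → ℝ) (T : ℝ) : Prop :=
  0 < T ∧ Function.Periodic (fun t => (x t, v t)) T ∧
    ∀ T' : ℝ, 0 < T' → T' < T → ¬ Function.Periodic (fun t => (x t, v t)) T'

/-- The origin is an isochronous center of `E(x, x', x'') = 0` (with `x` in `S`): it is an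
equilibrium, and there is a neighbourhood of the origin of the phase plane such that every other
point of it lies on a closed orbit, all these closed orbits having the same minimal period `T`. -/
def IsIsochronousCenter (E : ℝ → ℝ → ℝ → ℝ) (S : Set ℝ) : Prop :=
  E 0 0 0 = 0 ∧
    ∃ T : ℝ, ∃ U ∈ 𝓝 ((0 : ℝ), (0 : ℝ)), ∀ p ∈ U, p ≠ (0, 0) →
      ∃ x v : ℝ → ℝ, x 0 = p.1 ∧ v 0 = p.2 ∧ SolvesOn E S univ x v ∧ HasMinimalPeriod x v T

/-!
The energy coordinate `s(x) = sgn(x) √(2 H(x))` is analytic with positive derivative on a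
neighbourhood of `[a, b]` (`analyticAt_energyCoord_zero`, `exists_isEnergyChart`): away from `0` this
is clear, and near `0` one has `H(x) = x² G(x)` with `G(0) = h'(0) / 2 > 0`. It maps `[a, b]` onto
`[-c, c]` and has an analytic inverse `g`. As `s² = 2H`, preserving `H` and changing the sign means
`s ↦ -s`, so the involution is `A(x) = g(-s(x))`, and its uniqueness, analyticity and `A' < 0` follow.

Solutions of the two equations correspond to each other under `(y, y') ↦ (A(y), A'(y) y')`, which is
an involution of the phase plane fixing the origin. It therefore carries an isochronous center of
one equation to one of the other (`IsIsochronousCenter.of_conj`).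

Both conditions on `A` say that `s(x) = (x - A(x)) / 2`: since `s s' = h`, the one with `A'` is the
derivative of `2H(x) = ((x - A(x)) / 2)²`. In terms of `g` they read `g(u) - g(-u) = 2u`.

The orbits of the potential equation are `x = g(r sin θ)`, `x' = r cos θ` with
`dt = g'(r sin θ) dθ` (`IsEnergyChart.exists_orbit`), so the period at amplitude `r` is
`P(r) = ∫₀^{2π} g'(r sin θ) dθ`, in which only the even part of `g'` counts. If
`g(u) - g(-u) = 2u`, this even part is `1` and `P = 2π`. Conversely, let the center be isochronous
with period `T`. Since solutions are determined by their initial values, `P(r) = T` for small `r`, so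
the even analytic function `g'(u) + g'(-u) - T / π` has mean `0` over every small circle. A nonzero
one would have a constant sign near `0`, so it vanishes near `0`
(`AnalyticAt.eventually_eq_zero_of_integral_mul_sin`). When `h'(0) = 1` we have `g'(0) = 1`, so
`T = 2π`, and the identity theorem gives `g(u) - g(-u) = 2u` on all of `[-c, c]`.
-/

/-! ### Real analytic functions of one variable -/

/-- On the real line an antiderivative of an analytic function is analytic: its power series is
obtained by integrating term by term. -/
theorem AnalyticAt.of_hasDerivAt {f F : ℝ → ℝ} {x : ℝ} (hf : AnalyticAt ℝ f x)
    (hF : ∀ᶠ y in 𝓝 x, HasDerivAt F (f y) y) : AnalyticAt ℝ F x := by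
  obtain ⟨p, r, hp⟩ := hf
  obtain ⟨ρ, hρ0, hρ⟩ : ∃ ρ : NNReal, 0 < ρ ∧ (ρ : ENNReal) < r := by
    obtain ⟨ρ, h1, h2⟩ := ENNReal.lt_iff_exists_nnreal_btwn.1 hp.r_pos
    exact ⟨ρ, by exact_mod_cast h1, h2⟩
  obtain ⟨ε, hε, hFε⟩ := Metric.eventually_nhds_iff.1 hF
  -- the term of degree `0` has the junk quotient `_ / 0 = 0`, and `F x` is added separately
  let q : FormalMultilinearSeries ℝ ℝ ℝ :=
    FormalMultilinearSeries.ofScalars ℝ (fun n : ℕ => p.coeff (n - 1) / n)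
  have hq : ∀ n, q.coeff n = p.coeff (n - 1) / n := fun n => by
    simp [q, FormalMultilinearSeries.coeff_ofScalars]
  have key : HasFPowerSeriesAt (fun y => F y - F x) q x := by
    rw [hasFPowerSeriesAt_iff]
    have hmin : 0 < min ε (ρ : ℝ) := lt_min hε (by exact_mod_cast hρ0)
    filter_upwards [Metric.ball_mem_nhds (0 : ℝ) hmin] with u hu
    rw [mem_ball_zero_iff, lt_min_iff, Real.norm_eq_abs] at hu
    have habs : ∀ t ∈ uIcc (0 : ℝ) u, |t| ≤ |u| := fun t ht => by
      rcases le_total 0 u with h | h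
      · rw [uIcc_of_le h] at ht
        rw [abs_of_nonneg ht.1, abs_of_nonneg h]; exact ht.2
      · rw [uIcc_of_ge h] at ht
        rw [abs_of_nonpos ht.2, abs_of_nonpos h]; linarith [ht.1]
    have hderiv : ∀ t ∈ uIcc (0 : ℝ) u, HasDerivAt (fun t => F (x + t)) (f (x + t)) t :=
      fun t ht => by
        have := hFε (y := x + t) (by
          simpa [Real.dist_eq] using (habs t ht).trans_lt hu.1)
        simpa using this.comp_const_add x t
    have hsum : ∀ t ∈ uIcc (0 : ℝ) u, HasSum (fun n => t ^ n * p.coeff n) (f (x + t)) :=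
      fun t ht => by
        have hmem : t ∈ Metric.eball (0 : ℝ) r := by
          rw [Metric.mem_eball, edist_zero_right]
          refine lt_trans ?_ hρ
          rw [← ofReal_norm, Real.norm_eq_abs, ENNReal.ofReal_lt_coe_iff (by simp)]
          exact (habs t ht).trans_lt hu.2
        simpa using hp.hasSum hmem
    have hcont : ContinuousOn (fun t => f (x + t)) (uIcc 0 u) := by
      intro t ht
      have hmem : x + t ∈ Metric.eball x r := by
        rw [Metric.mem_eball, edist_dist, Real.dist_eq]
        refine lt_trans ?_ hρ
        rw [ENNReal.ofReal_lt_coe_iff (abs_nonneg _)]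
        simpa using (habs t ht).trans_lt hu.2
      have hc : ContinuousAt f (x + t) := (hp.analyticAt_of_mem hmem).continuousAt
      exact (ContinuousAt.comp (f := fun t => x + t) hc (by fun_prop)).continuousWithinAt
    have hint : (∫ t in (0 : ℝ)..u, f (x + t)) = F (x + u) - F x := by
      rw [intervalIntegral.integral_eq_sub_of_hasDerivAt hderiv hcont.intervalIntegrable]
      simp
    have hbd : Summable fun n => ‖p n‖ * (ρ : ℝ) ^ n :=
      p.summable_norm_mul_pow (hρ.trans_le hp.r_le)
    have hs : HasSum (fun n => ∫ t in (0 : ℝ)..u, t ^ n * p.coeff n)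
        (∫ t in (0 : ℝ)..u, f (x + t)) := by
      refine intervalIntegral.hasSum_integral_of_dominated_convergence
        (fun n _ => ‖p n‖ * (ρ : ℝ) ^ n) ?_ ?_ ?_ ?_ ?_
      · exact fun n => (by fun_prop : Continuous fun t : ℝ => t ^ n * p.coeff n).aestronglyMeasurable
      · refine fun n => Eventually.of_forall fun t ht => ?_
        rw [norm_mul, norm_pow, Real.norm_eq_abs, mul_comm]
        have h1 : ‖p.coeff n‖ ≤ ‖p n‖ := by simp
        have h2 : |t| ≤ ρ := (habs t (uIoc_subset_uIcc ht)).trans hu.2.le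
        gcongr
      · exact Eventually.of_forall fun _ _ => hbd
      · exact intervalIntegrable_const
      · exact Eventually.of_forall fun t ht => hsum t (uIoc_subset_uIcc ht)
    rw [hint] at hs
    have hterm : ∀ n : ℕ, (∫ t in (0 : ℝ)..u, t ^ n * p.coeff n) = u ^ (n + 1) * q.coeff (n + 1) :=
      fun n => by
        rw [hq, intervalIntegral.integral_mul_const, integral_pow]
        simp
        ring
    simp_rw [hterm] at hs
    have := (hasSum_nat_add_iff (f := fun n => u ^ n * q.coeff n) 1).1 hs
    simpa [hq] using this
  have := key.analyticAt.add (analyticAt_const (v := F x))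
  exact this.congr (Eventually.of_forall fun y => by simp)

theorem AnalyticAt.real_sqrt {f : ℝ → ℝ} {x : ℝ} (hf : AnalyticAt ℝ f x) (h : f x ≠ 0) :
    AnalyticAt ℝ (fun y => √(f y)) x := by
  have h1 : AnalyticAt ℝ Real.sqrt (f x) :=
    (Real.contDiffAt_sqrt h).analyticAt
  exact h1.comp hf

/-- Inverse function theorem on a compact interval: an analytic function with positive derivative
has an inverse that is analytic on a neighbourhood of the image, end points included. -/
theorem AnalyticOnNhd.exists_leftInverse {s : ℝ → ℝ} {a b : ℝ} (hab : a ≤ b)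
    (hs : AnalyticOnNhd ℝ s (Icc a b)) (hd : ∀ x ∈ Icc a b, 0 < deriv s x) :
    StrictMonoOn s (Icc a b) ∧ ∃ g : ℝ → ℝ, AnalyticOnNhd ℝ g (Icc (s a) (s b)) ∧
      (∀ x ∈ Icc a b, g (s x) = x) ∧
      ∀ u ∈ Icc (s a) (s b), g u ∈ Icc a b ∧ s (g u) = u := by
  let W : Set ℝ := {x | AnalyticAt ℝ s x ∧ 0 < deriv s x}
  have hW : IsOpen W := by
    rw [isOpen_iff_mem_nhds]
    rintro x ⟨h1, h2⟩
    exact h1.eventually_analyticAt.and (h1.deriv.continuousAt.eventually (lt_mem_nhds h2))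
  obtain ⟨δ, hδ, hsub⟩ := isCompact_Icc.exists_thickening_subset_open hW
    (fun x hx => ⟨hs x hx, hd x hx⟩ : Icc a b ⊆ W)
  -- the inverse is taken on a convex open neighbourhood of `[a, b]`
  set V := Metric.thickening δ (Icc a b)
  have hVc : Convex ℝ V := (convex_Icc a b).thickening δ
  have hVo : IsOpen V := Metric.isOpen_thickening
  have hIV : Icc a b ⊆ V := Metric.self_subset_thickening hδ _
  have hmono : StrictMonoOn s V := strictMonoOn_of_deriv_pos hVc
    (fun x hx => (hsub hx).1.continuousAt.continuousWithinAt)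
    (fun x hx => (hsub (interior_subset hx)).2)
  have hleft : ∀ x ∈ V, Function.invFunOn s V (s x) = x := fun x hx =>
    hmono.injOn.leftInvOn_invFunOn hx
  have hsurj : ∀ u ∈ Icc (s a) (s b), ∃ x ∈ Icc a b, s x = u := fun u hu =>
    intermediate_value_Icc hab (fun x hx => (hs x hx).continuousAt.continuousWithinAt) hu
  refine ⟨hmono.mono hIV, Function.invFunOn s V, ?_, fun x hx => hleft x (hIV hx), ?_⟩
  · intro u hu
    obtain ⟨x, hx, rfl⟩ := hsurj u hu
    rw [← analyticAt_comp_iff_of_deriv_ne_zero (hs x hx) (hd x hx).ne']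
    refine (analyticAt_id (𝕜 := ℝ)).congr ?_
    filter_upwards [hVo.mem_nhds (hIV hx)] with y hy
    simp [hleft y hy]
  · intro u hu
    obtain ⟨x, hx, rfl⟩ := hsurj u hu
    rw [hleft x (hIV hx)]
    exact ⟨hx, rfl⟩

/-- The odd part of `f` does not contribute to the mean of `f` over a circle: shift `θ` by `π`. -/
theorem integral_comp_mul_sin_neg (f : ℝ → ℝ) (r : ℝ) :
    ∫ θ in (0 : ℝ)..2 * Real.pi, f (-(r * Real.sin θ)) =
      ∫ θ in (0 : ℝ)..2 * Real.pi, f (r * Real.sin θ) := by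
  have hper : Function.Periodic (fun θ => f (r * Real.sin θ)) (2 * Real.pi) := fun θ => by simp
  have h1 : ∀ θ, f (-(r * Real.sin θ)) = f (r * Real.sin (θ + Real.pi)) := fun θ => by
    simp
  simp_rw [h1]
  rw [intervalIntegral.integral_comp_add_right (fun θ => f (r * Real.sin θ)), zero_add, add_comm,
    hper.intervalIntegral_add_eq Real.pi 0, zero_add]

/-- An even analytic function whose means over all small circles vanish is zero near `0`: otherwise
it would have a constant sign on a punctured neighbourhood of `0`. -/
theorem AnalyticAt.eventually_eq_zero_of_integral_mul_sin {e : ℝ → ℝ} (he : AnalyticAt ℝ e 0)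
    (heven : ∀ u, e (-u) = e u) {ρ : ℝ} (hρ : 0 < ρ)
    (hint : ∀ r ∈ Ioo 0 ρ, ∫ θ in (0 : ℝ)..2 * Real.pi, e (r * Real.sin θ) = 0) :
    ∀ᶠ u in 𝓝 0, e u = 0 := by
  refine he.eventually_eq_zero_or_eventually_ne_zero.resolve_right fun hne => ?_
  obtain ⟨ε, hε, hall⟩ := Metric.eventually_nhds_iff.1
    ((eventually_nhdsWithin_iff.1 hne).and he.eventually_analyticAt)
  obtain ⟨r, hr0, hr⟩ : ∃ r, 0 < r ∧ r < min ε ρ := exists_between (lt_min hε hρ)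
  rw [lt_min_iff] at hr
  have hcont : ∀ u, |u| < ε → ContinuousAt e u := fun u hu =>
    (hall (by simpa [Real.dist_eq] using hu)).2.continuousAt
  have hne' : ∀ u, |u| < ε → u ≠ 0 → e u ≠ 0 := fun u hu =>
    (hall (by simpa [Real.dist_eq] using hu)).1
  have hsin : ∀ θ, |r * Real.sin θ| ≤ r := fun θ => by
    rw [abs_mul, abs_of_pos hr0]
    exact mul_le_of_le_one_right hr0.le (Real.abs_sin_le_one θ)
  -- after a change of sign, `e` is positive on the punctured interval
  obtain ⟨σ, hσ⟩ : ∃ σ : ℝ, ∀ u, |u| < ε → u ≠ 0 → 0 < σ * e u := by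
    have hpre : IsPreconnected (Ioo 0 ε) := isPreconnected_Ioo
    have hc : ContinuousOn e (Ioo 0 ε) := fun u hu =>
      (hcont u (by rw [abs_of_pos hu.1]; exact hu.2)).continuousWithinAt
    have hr' : r ∈ Ioo 0 ε := ⟨hr0, hr.1⟩
    have hsame : ∀ u ∈ Ioo 0 ε, 0 < e r * e u := by
      intro u hu
      have hnz : ∀ z ∈ Ioo 0 ε, e z ≠ 0 := fun z hz =>
        hne' z (by rw [abs_of_pos hz.1]; exact hz.2) hz.1.ne'
      rcases lt_or_gt_of_ne (hnz r hr') with h | h <;> rcases lt_or_gt_of_ne (hnz u hu) with h' | h'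
      · exact mul_pos_of_neg_of_neg h h'
      · obtain ⟨z, hz, hz0⟩ := hpre.intermediate_value hr' hu hc ⟨h.le, h'.le⟩
        exact absurd hz0 (hnz z hz)
      · obtain ⟨z, hz, hz0⟩ := hpre.intermediate_value hu hr' hc ⟨h'.le, h.le⟩
        exact absurd hz0 (hnz z hz)
      · exact mul_pos h h'
    refine ⟨e r, fun u hu hu0 => ?_⟩
    rcases lt_or_gt_of_ne hu0 with h | h
    · rw [← heven u]
      exact hsame _ ⟨by linarith, by rwa [abs_of_neg h] at hu⟩
    · exact hsame _ ⟨h, by rwa [abs_of_pos h] at hu⟩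
  have hzero : 0 ≤ σ * e 0 := by
    have h1 : Tendsto (fun u => σ * e u) (𝓝[≠] 0) (𝓝 (σ * e 0)) :=
      (he.continuousAt.tendsto.const_mul σ).mono_left nhdsWithin_le_nhds
    refine ge_of_tendsto h1 (eventually_nhdsWithin_iff.2 ?_)
    filter_upwards [Metric.ball_mem_nhds (0 : ℝ) hε] with u hu hu0
    exact (hσ u (by simpa using hu) hu0).le
  have hpos : 0 < ∫ θ in (0 : ℝ)..2 * Real.pi, σ * e (r * Real.sin θ) := by
    refine intervalIntegral.integral_pos (by positivity) (fun θ _ => ?_) (fun θ _ => ?_)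
      ⟨Real.pi / 2, ⟨by positivity, by linarith [Real.pi_pos]⟩, ?_⟩
    · have : ContinuousAt e (r * Real.sin θ) := hcont _ ((hsin θ).trans_lt hr.1)
      exact (continuousAt_const.mul
        (ContinuousAt.comp (f := fun θ => r * Real.sin θ) this (by fun_prop))).continuousWithinAt
    · by_cases h : r * Real.sin θ = 0
      · rw [h]; exact hzero
      · exact (hσ _ ((hsin θ).trans_lt hr.1) h).le
    · have := hσ r (by rw [abs_of_pos hr0]; exact hr.1) hr0.ne'
      simpa using this
  rw [intervalIntegral.integral_const_mul, hint r ⟨hr0, hr.2⟩, mul_zero] at hpos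
  exact lt_irrefl _ hpos

/-! ### The energy coordinate -/

/-- The energy coordinate `sgn(x) √(2 H(x))`, in which the potential of `h` is that of the harmonic
oscillator. -/
noncomputable def energyCoord (h : ℝ → ℝ) (x : ℝ) : ℝ := Real.sign x * √(2 * potential h x)

/-- `g` is an analytic inverse of the energy coordinate of `h`, which is an increasing analytic
bijection from `[a, b]` to `[-c, c]`. Analyticity on a closed interval is meant on a neighbourhood
of it; the values of `g` off `[-c, c]` are not constrained further. -/
structure IsEnergyChart (h : ℝ → ℝ) (a b c : ℝ) (g : ℝ → ℝ) : Prop where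
  neg : a < 0
  pos : 0 < b
  c_pos : 0 < c
  analytic : AnalyticOnNhd ℝ (energyCoord h) (Icc a b)
  coord_left : energyCoord h a = -c
  coord_right : energyCoord h b = c
  deriv_pos : ∀ x ∈ Icc a b, 0 < deriv (energyCoord h) x
  strictMono : StrictMonoOn (energyCoord h) (Icc a b)
  sq_eq : ∀ x ∈ Icc a b, energyCoord h x ^ 2 = 2 * potential h x
  mul_deriv : ∀ x ∈ Icc a b, energyCoord h x * deriv (energyCoord h) x = h x
  sq_deriv_zero : deriv (energyCoord h) 0 ^ 2 = deriv h 0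
  analytic_inv : AnalyticOnNhd ℝ g (Icc (-c) c)
  inv_coord : ∀ x ∈ Icc a b, g (energyCoord h x) = x
  inv_mem : ∀ u ∈ Icc (-c) c, g u ∈ Icc a b
  coord_inv : ∀ u ∈ Icc (-c) c, energyCoord h (g u) = u

section Coordinate

variable {h : ℝ → ℝ} {a b : ℝ}

theorem hasDerivAt_potential (ha : a < 0) (hb : 0 < b) (han : AnalyticOnNhd ℝ h (Icc a b))
    {x : ℝ} (hx : x ∈ Icc a b) : ∀ᶠ y in 𝓝 x, HasDerivAt (potential h) (h y) y := by
  obtain ⟨δ, hδ, hsub⟩ := isCompact_Icc.exists_thickening_subset_open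
    (isOpen_analyticAt ℝ h) (fun x hx => han x hx : Icc a b ⊆ {x | AnalyticAt ℝ h x})
  have hIV : Icc a b ⊆ Metric.thickening δ (Icc a b) := Metric.self_subset_thickening hδ _
  filter_upwards [Metric.isOpen_thickening.mem_nhds (hIV hx)] with y hy
  have hseg : uIcc 0 y ⊆ Metric.thickening δ (Icc a b) := by
    rw [← segment_eq_uIcc]
    exact ((convex_Icc a b).thickening δ).segment_subset (hIV ⟨ha.le, hb.le⟩) hy
  have hc : ContinuousOn h (uIcc 0 y) := fun z hz =>
    (hsub (hseg hz)).continuousAt.continuousWithinAt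
  have hcd : ContinuousOn h (Metric.thickening δ (Icc a b)) := fun z hz =>
    (hsub hz).continuousAt.continuousWithinAt
  exact intervalIntegral.integral_hasDerivAt_right hc.intervalIntegrable
    (hcd.stronglyMeasurableAtFilter Metric.isOpen_thickening y hy) (hsub hy).continuousAt

theorem analyticOnNhd_potential (ha : a < 0) (hb : 0 < b) (han : AnalyticOnNhd ℝ h (Icc a b)) :
    AnalyticOnNhd ℝ (potential h) (Icc a b) := fun x hx =>
  (han x hx).of_hasDerivAt (hasDerivAt_potential ha hb han hx)

theorem potential_zero (h : ℝ → ℝ) : potential h 0 = 0 := by simp [potential]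

theorem energyCoord_zero (h : ℝ → ℝ) : energyCoord h 0 = 0 := by simp [energyCoord]

theorem potential_pos (ha : a < 0) (hb : 0 < b) (han : AnalyticOnNhd ℝ h (Icc a b))
    (hpos : ∀ x ∈ Icc a b, x ≠ 0 → 0 < x * h x) {x : ℝ} (hx : x ∈ Icc a b) (hx0 : x ≠ 0) :
    0 < potential h x := by
  have hc : ContinuousOn (potential h) (Icc a b) :=
    (analyticOnNhd_potential ha hb han).continuousOn
  have hd : ∀ y ∈ Icc a b, deriv (potential h) y = h y := fun y hy =>
    (hasDerivAt_potential ha hb han hy).self_of_nhds.deriv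
  rw [← potential_zero h]
  rcases lt_or_gt_of_ne hx0 with h' | h'
  · refine strictAntiOn_of_deriv_neg (convex_Icc a 0)
      (hc.mono (Icc_subset_Icc_right hb.le)) (fun y hy => ?_) ⟨hx.1, h'.le⟩ ⟨ha.le, le_rfl⟩ h'
    rw [interior_Icc] at hy
    have hy' : y ∈ Icc a b := ⟨hy.1.le, (hy.2.trans hb).le⟩
    rw [hd y hy']
    exact neg_of_mul_pos_right (hpos y hy' hy.2.ne) hy.2.le
  · refine strictMonoOn_of_deriv_pos (convex_Icc 0 b)
      (hc.mono (Icc_subset_Icc_left ha.le)) (fun y hy => ?_) ⟨le_rfl, hb.le⟩ ⟨h'.le, hx.2⟩ h'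
    rw [interior_Icc] at hy
    have hy' : y ∈ Icc a b := ⟨(ha.trans hy.1).le, hy.2.le⟩
    rw [hd y hy']
    exact pos_of_mul_pos_right (hpos y hy' hy.1.ne') hy.1.le

/-- Near `0` the potential is `x² G(x)` with `G` analytic and `G(0) = h'(0) / 2`. -/
theorem exists_potential_eq_sq_mul (hH : AnalyticAt ℝ (potential h) 0)
    (hd : ∀ᶠ y in 𝓝 0, HasDerivAt (potential h) (h y) y) (h0 : h 0 = 0) :
    ∃ G : ℝ → ℝ, AnalyticAt ℝ G 0 ∧ G 0 = deriv h 0 / 2 ∧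
      ∀ᶠ x in 𝓝 0, potential h x = x ^ 2 * G x := by
  have hds : ∀ {f : ℝ → ℝ}, AnalyticAt ℝ f 0 → AnalyticAt ℝ (dslope f 0) 0 := fun ⟨_, hp⟩ =>
    ⟨_, hp.has_fpower_series_dslope_fslope⟩
  have hmul : ∀ {f : ℝ → ℝ}, f 0 = 0 → ∀ x, f x = x * dslope f 0 x := fun {f} hf x => by
    have := sub_smul_dslope f 0 x
    simpa [hf] using this.symm
  set G := dslope (dslope (potential h) 0) 0
  have hG : AnalyticAt ℝ G 0 := hds (hds hH)
  have h1 : dslope (potential h) 0 0 = 0 := by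
    rw [dslope_same, hd.self_of_nhds.deriv, h0]
  have heq : ∀ x, potential h x = x ^ 2 * G x := fun x => by
    rw [hmul (potential_zero h) x, hmul h1 x]; ring
  refine ⟨G, hG, ?_, Eventually.of_forall heq⟩
  have hh : h =ᶠ[𝓝 0] fun x => 2 * x * G x + x ^ 2 * deriv G x := by
    filter_upwards [hd, hG.eventually_analyticAt] with x hx hGx
    have h2 : HasDerivAt (fun x => x ^ 2 * G x) (2 * x * G x + x ^ 2 * deriv G x) x := by
      simpa using (hasDerivAt_pow 2 x).fun_mul hGx.differentiableAt.hasDerivAt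
    exact hx.unique (by simpa only [← heq] using h2)
  have h3 : HasDerivAt (fun x => 2 * x * G x + x ^ 2 * deriv G x) (2 * G 0) 0 := by
    have hA := ((hasDerivAt_id (0 : ℝ)).const_mul 2).fun_mul hG.differentiableAt.hasDerivAt
    have hB := (hasDerivAt_pow 2 (0 : ℝ)).fun_mul hG.deriv.differentiableAt.hasDerivAt
    simpa using hA.fun_add hB
  rw [hh.deriv_eq, h3.deriv]
  ring

theorem analyticAt_energyCoord_zero (hH : AnalyticAt ℝ (potential h) 0)
    (hd : ∀ᶠ y in 𝓝 0, HasDerivAt (potential h) (h y) y) (h0 : h 0 = 0) (h1 : 0 < deriv h 0) :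
    AnalyticAt ℝ (energyCoord h) 0 ∧ deriv (energyCoord h) 0 = √(deriv h 0) := by
  obtain ⟨G, hG, hG0, heq⟩ := exists_potential_eq_sq_mul hH hd h0
  have hs : (fun x => x * √(2 * G x)) =ᶠ[𝓝 0] energyCoord h := by
    filter_upwards [heq] with x hx
    rw [energyCoord, hx, show 2 * (x ^ 2 * G x) = x ^ 2 * (2 * G x) by ring,
      Real.sqrt_mul (sq_nonneg x), Real.sqrt_sq_eq_abs, ← mul_assoc, mul_comm (Real.sign x)]
    congr 1
    rcases lt_trichotomy x 0 with h | h | h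
    · simp [Real.sign_of_neg h, abs_of_neg h]
    · simp [h]
    · simp [Real.sign_of_pos h, abs_of_pos h]
  have hr : AnalyticAt ℝ (fun x => √(2 * G x)) 0 :=
    (analyticAt_const.fun_mul hG).real_sqrt (by rw [hG0]; linarith)
  refine ⟨(analyticAt_id.mul hr).congr hs, ?_⟩
  rw [← hs.deriv_eq]
  have := (hasDerivAt_id (0 : ℝ)).fun_mul hr.differentiableAt.hasDerivAt
  have h2 : HasDerivAt (fun x => x * √(2 * G x)) (√(2 * G 0)) 0 := by
    simpa only [id, one_mul, zero_mul, add_zero] using this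
  rw [h2.deriv, hG0]
  congr 1
  ring

theorem exists_isEnergyChart (ha : a < 0) (hb : 0 < b)
    (han : AnalyticOnNhd ℝ h (Icc a b)) (h0 : h 0 = 0) (h1 : 0 < deriv h 0)
    (hpos : ∀ x ∈ Icc a b, x ≠ 0 → 0 < x * h x) (hab : potential h a = potential h b) :
    ∃ c g, IsEnergyChart h a b c g := by
  have hI0 : (0 : ℝ) ∈ Icc a b := ⟨ha.le, hb.le⟩
  have hHpos := fun {x} => potential_pos (x := x) ha hb han hpos
  have hH := analyticOnNhd_potential ha hb han
  have hd := fun {x} => hasDerivAt_potential (x := x) ha hb han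
  have hs0 := analyticAt_energyCoord_zero (hH 0 hI0) (hd hI0) h0 h1
  have hsq : ∀ x ∈ Icc a b, energyCoord h x ^ 2 = 2 * potential h x := fun x hx => by
    rcases eq_or_ne x 0 with rfl | hx0
    · simp [energyCoord_zero, potential_zero]
    · rw [energyCoord, mul_pow, Real.sq_sqrt (by linarith [hHpos hx hx0])]
      rcases lt_or_gt_of_ne hx0 with h' | h'
      · simp [Real.sign_of_neg h']
      · simp [Real.sign_of_pos h']
  have han' : AnalyticOnNhd ℝ (energyCoord h) (Icc a b) := fun x hx => by
    rcases eq_or_ne x 0 with rfl | hx0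
    · exact hs0.1
    · have hr : AnalyticAt ℝ (fun y => √(2 * potential h y)) x :=
        (analyticAt_const.fun_mul (hH x hx)).real_sqrt (by linarith [hHpos hx hx0])
      refine (analyticAt_const (v := Real.sign x)).mul hr |>.congr ?_
      rcases lt_or_gt_of_ne hx0 with h' | h'
      · filter_upwards [Iio_mem_nhds h'] with y hy
        simp [energyCoord, Real.sign_of_neg h', Real.sign_of_neg hy]
      · filter_upwards [Ioi_mem_nhds h'] with y hy
        simp [energyCoord, Real.sign_of_pos h', Real.sign_of_pos hy]
  have hmul : ∀ x ∈ Icc a b, energyCoord h x * deriv (energyCoord h) x = h x := fun x hx => by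
    -- inside the interval `s² = 2H` can be differentiated; `derivWithin` covers the end points
    have hu : UniqueDiffWithinAt ℝ (Icc a b) x := uniqueDiffOn_Icc (ha.trans hb) x hx
    have hl : HasDerivWithinAt (fun y => energyCoord h y ^ 2)
        (2 * energyCoord h x * deriv (energyCoord h) x) (Icc a b) x := by
      simpa using ((han' x hx).differentiableAt.hasDerivAt.fun_pow 2).hasDerivWithinAt (s := Icc a b)
    have hr : HasDerivWithinAt (fun y => 2 * potential h y) (2 * h x) (Icc a b) x :=
      ((hd hx).self_of_nhds.const_mul 2).hasDerivWithinAt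
    have := hu.eq_deriv _ hl (hr.congr hsq (hsq x hx))
    linarith
  have hdpos : ∀ x ∈ Icc a b, 0 < deriv (energyCoord h) x := fun x hx => by
    rcases eq_or_ne x 0 with rfl | hx0
    · rw [hs0.2]; exact Real.sqrt_pos.2 h1
    · have hp := hpos x hx hx0
      have hq : 0 < √(2 * potential h x) := Real.sqrt_pos.2 (by linarith [hHpos hx hx0])
      have hm := hmul x hx
      rcases lt_or_gt_of_ne hx0 with h' | h'
      · rw [energyCoord, Real.sign_of_neg h'] at hm
        have : h x < 0 := neg_of_mul_pos_right hp h'.le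
        refine pos_of_mul_pos_right (a := √(2 * potential h x)) ?_ hq.le
        linarith
      · rw [energyCoord, Real.sign_of_pos h', one_mul] at hm
        have : 0 < h x := pos_of_mul_pos_right hp h'.le
        refine pos_of_mul_pos_right (a := √(2 * potential h x)) ?_ hq.le
        rwa [hm]
  obtain ⟨hmono, g, hg, hgs, hsg⟩ := han'.exists_leftInverse (ha.trans hb).le hdpos
  have hsb : energyCoord h b = √(2 * potential h b) := by
    simp [energyCoord, Real.sign_of_pos hb]
  have hsa : energyCoord h a = -√(2 * potential h b) := by
    simp [energyCoord, Real.sign_of_neg ha, hab]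
  rw [hsa, hsb] at hg hsg
  exact ⟨√(2 * potential h b), g, ha, hb,
    Real.sqrt_pos.2 (by linarith [hHpos ⟨(ha.trans hb).le, le_rfl⟩ hb.ne']), han', hsa, hsb, hdpos,
    hmono, hsq, hmul, by rw [hs0.2, Real.sq_sqrt h1.le], hg, hgs, fun u hu => (hsg u hu).1,
    fun u hu => (hsg u hu).2⟩

end Coordinate

/-! ### Orbits of the potential equation and their periods -/

theorem HasMinimalPeriod.unique {x v : ℝ → ℝ} {T T' : ℝ} (h : HasMinimalPeriod x v T)
    (h' : HasMinimalPeriod x v T') : T = T' := by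
  rcases lt_trichotomy T T' with hlt | heq | hlt
  · exact absurd h.2.1 (h'.2.2 T h.1 hlt)
  · exact heq
  · exact absurd h'.2.1 (h.2.2 T' h'.1 hlt)

theorem solvesOn_potentialEq_unique {h : ℝ → ℝ} {a b : ℝ} (han : AnalyticOnNhd ℝ h (Icc a b))
    {x v x' v' : ℝ → ℝ} (hs : SolvesOn (potentialEq h) (Icc a b) univ x v)
    (hs' : SolvesOn (potentialEq h) (Icc a b) univ x' v') (hx : x 0 = x' 0) (hv : v 0 = v' 0) :
    x = x' ∧ v = v' := by
  have hC1 : ContDiffOn ℝ 1 h (Icc a b) := fun x hx => (han x hx).contDiffAt.contDiffWithinAt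
  obtain ⟨K, hK⟩ := hC1.exists_lipschitzOnWith one_ne_zero (convex_Icc a b) isCompact_Icc
  have hfield : LipschitzOnWith (max 1 K) (fun p : ℝ × ℝ => (p.2, -h p.1)) (Icc a b ×ˢ univ) := by
    refine (LipschitzWith.prod_snd.lipschitzOnWith).prodMk ?_
    have h1 : LipschitzOnWith (K * 1) (fun p => h p.1) (Icc a b ×ˢ (univ : Set ℝ)) :=
      hK.comp LipschitzWith.prod_fst.lipschitzOnWith (fun p hp => hp.1)
    rw [mul_one] at h1
    exact h1.neg
  have hsol : ∀ {y w : ℝ → ℝ}, SolvesOn (potentialEq h) (Icc a b) univ y w → ∀ t,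
      HasDerivAt (fun t => (y t, w t)) ((w t, -h (y t)) : ℝ × ℝ) t ∧
        (y t, w t) ∈ Icc a b ×ˢ (univ : Set ℝ) := fun {y w} hyw t => by
    obtain ⟨h1, h2, d, h3, h4⟩ := hyw t (mem_univ t)
    have hd : d = -h (y t) := eq_neg_of_add_eq_zero_left h4
    exact ⟨h2.prodMk (hd ▸ h3), h1, mem_univ _⟩
  have := ODE_solution_unique_univ (v := fun _ (p : ℝ × ℝ) => (p.2, -h p.1)) (t₀ := 0)
    (fun _ => hfield) (hsol hs) (hsol hs') (by simp [hx, hv])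
  exact ⟨funext fun t => congrArg Prod.fst (congrFun this t),
    funext fun t => congrArg Prod.snd (congrFun this t)⟩

namespace IsEnergyChart

variable {h : ℝ → ℝ} {a b c : ℝ} {g : ℝ → ℝ}

theorem zero_mem (hC : IsEnergyChart h a b c g) : (0 : ℝ) ∈ Icc a b := ⟨hC.neg.le, hC.pos.le⟩

theorem inv_zero (hC : IsEnergyChart h a b c g) : g 0 = 0 := by
  simpa [energyCoord_zero] using hC.inv_coord 0 hC.zero_mem

theorem coord_mem (hC : IsEnergyChart h a b c g) {x : ℝ} (hx : x ∈ Icc a b) :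
    energyCoord h x ∈ Icc (-c) c := by
  have hab := (hC.neg.trans hC.pos).le
  rw [← hC.coord_left, ← hC.coord_right]
  exact ⟨hC.strictMono.monotoneOn ⟨le_rfl, hab⟩ hx hx.1,
    hC.strictMono.monotoneOn hx ⟨hab, le_rfl⟩ hx.2⟩

theorem deriv_inv_mul (hC : IsEnergyChart h a b c g) {u : ℝ} (hu : u ∈ Ioo (-c) c) :
    deriv (energyCoord h) (g u) * deriv g u = 1 := by
  have hu' := Ioo_subset_Icc_self hu
  have h1 : HasDerivAt (fun y => energyCoord h (g y)) (deriv (energyCoord h) (g u) * deriv g u) u :=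
    (hC.analytic _ (hC.inv_mem u hu')).differentiableAt.hasDerivAt.comp u
      (hC.analytic_inv u hu').differentiableAt.hasDerivAt
  refine h1.unique ((hasDerivAt_id u).congr_of_eventuallyEq ?_)
  filter_upwards [Icc_mem_nhds hu.1 hu.2] with y hy using hC.coord_inv y hy

theorem deriv_inv_pos (hC : IsEnergyChart h a b c g) {u : ℝ} (hu : u ∈ Ioo (-c) c) :
    0 < deriv g u := by
  refine pos_of_mul_pos_right (a := deriv (energyCoord h) (g u)) ?_
    (hC.deriv_pos _ (hC.inv_mem u (Ioo_subset_Icc_self hu))).le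
  rw [hC.deriv_inv_mul hu]
  exact one_pos

theorem mul_sin_mem {r c : ℝ} (hr : 0 < r) (hrc : r < c) (θ : ℝ) :
    r * Real.sin θ ∈ Ioo (-c) c := by
  rw [mem_Ioo, ← abs_lt, abs_mul, abs_of_pos hr]
  exact (mul_le_of_le_one_right hr.le (Real.abs_sin_le_one θ)).trans_lt hrc

theorem continuous_deriv_inv_mul_sin (hC : IsEnergyChart h a b c g) {r : ℝ} (hr : 0 < r)
    (hrc : r < c) : Continuous fun θ => deriv g (r * Real.sin θ) :=
  continuous_iff_continuousAt.2 fun θ =>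
    ContinuousAt.comp (f := fun θ => r * Real.sin θ)
      (hC.analytic_inv _ (Ioo_subset_Icc_self (mul_sin_mem hr hrc θ))).deriv.continuousAt
      (by fun_prop)

/-- The orbits of the potential equation are the curves `x = g(r sin θ)`, `x' = r cos θ`, run
through with `dt = g'(r sin θ) dθ`. -/
theorem exists_orbit (hC : IsEnergyChart h a b c g) {r : ℝ} (hr : 0 < r) (hrc : r < c) (θ₀ : ℝ) :
    ∃ x v : ℝ → ℝ, x 0 = g (r * Real.sin θ₀) ∧ v 0 = r * Real.cos θ₀ ∧
      SolvesOn (potentialEq h) (Icc a b) univ x v ∧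
      HasMinimalPeriod x v (∫ θ in (0 : ℝ)..2 * Real.pi, deriv g (r * Real.sin θ)) := by
  have hmem := mul_sin_mem hr hrc
  set q : ℝ → ℝ := fun θ => deriv g (r * Real.sin θ) with hq
  have hqc : Continuous q := hC.continuous_deriv_inv_mul_sin hr hrc
  have hqpos : ∀ θ, 0 < q θ := fun θ => hC.deriv_inv_pos (hmem θ)
  have hqper : Function.Periodic q (2 * Real.pi) := fun θ => by simp [hq]
  -- `τ` is the time at angle `θ`, and `Θ` is its inverse
  set τ : ℝ → ℝ := fun θ => ∫ φ in (0 : ℝ)..θ, q φ with hτ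
  have hτd : ∀ θ, HasDerivAt τ (q θ) θ := fun θ => hqc.integral_hasStrictDerivAt 0 θ |>.hasDerivAt
  have hτm : StrictMono τ := strictMono_of_deriv_pos fun θ => by
    rw [(hτd θ).deriv]; exact hqpos θ
  have hτs : Function.Surjective τ :=
    Continuous.surjective (continuous_iff_continuousAt.2 fun θ => (hτd θ).continuousAt)
      (hqper.tendsto_atTop_intervalIntegral_of_pos' (hqc.intervalIntegrable _ _) hqpos
        Real.two_pi_pos)
      (hqper.tendsto_atBot_intervalIntegral_of_pos' (hqc.intervalIntegrable _ _) hqpos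
        Real.two_pi_pos)
  set P := ∫ θ in (0 : ℝ)..2 * Real.pi, q θ with hP
  have hτP : ∀ θ, τ (θ + 2 * Real.pi) = τ θ + P := fun θ => by
    have := hqper.intervalIntegral_add_eq_add 0 θ (fun _ _ => hqc.intervalIntegrable _ _)
    simpa [hτ, hP] using this
  have hPpos : 0 < P :=
    intervalIntegral.intervalIntegral_pos_of_pos (hqc.intervalIntegrable _ _) hqpos
      Real.two_pi_pos
  let e := hτm.orderIsoOfSurjective τ hτs
  let Θ : ℝ → ℝ := e.symm
  have hΘτ : ∀ θ, Θ (τ θ) = θ := fun θ => e.symm_apply_apply θ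
  have hτΘ : ∀ t, τ (Θ t) = t := fun t => e.apply_symm_apply t
  have hΘm : StrictMono Θ := e.symm.strictMono
  have hΘP : ∀ t, Θ (t + P) = Θ t + 2 * Real.pi := fun t => by
    rw [← hΘτ (Θ t + 2 * Real.pi), hτP, hτΘ]
  have hΘd : ∀ t, HasDerivAt Θ (q (Θ t))⁻¹ t := fun t =>
    (hτd (Θ t)).of_local_left_inverse e.symm.continuous.continuousAt (hqpos _).ne'
      (Eventually.of_forall hτΘ)
  set t₀ := τ θ₀
  have hΦd : ∀ t, HasDerivAt (fun t => Θ (t + t₀)) (q (Θ (t + t₀)))⁻¹ t := fun t =>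
    (hΘd (t + t₀)).comp_add_const t t₀
  refine ⟨fun t => g (r * Real.sin (Θ (t + t₀))), fun t => r * Real.cos (Θ (t + t₀)),
    by simp [t₀, hΘτ], by simp [t₀, hΘτ], ?_, hPpos, ?_, ?_⟩
  · intro t _
    have hu := hmem (Θ (t + t₀))
    have hne := (hqpos (Θ (t + t₀))).ne'
    refine ⟨hC.inv_mem _ (Ioo_subset_Icc_self hu), ?_,
      r * (-Real.sin (Θ (t + t₀)) * (q (Θ (t + t₀)))⁻¹), (hΦd t).cos.const_mul r, ?_⟩
    · have h1 : HasDerivAt g (q (Θ (t + t₀))) (r * Real.sin (Θ (t + t₀))) :=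
        (hC.analytic_inv _ (Ioo_subset_Icc_self hu)).differentiableAt.hasDerivAt
      have h2 := h1.comp t ((hΦd t).sin.const_mul r)
      refine h2.congr_deriv ?_
      field_simp
    · have h1 := hC.mul_deriv _ (hC.inv_mem _ (Ioo_subset_Icc_self hu))
      rw [hC.coord_inv _ (Ioo_subset_Icc_self hu),
        eq_inv_of_mul_eq_one_left (hC.deriv_inv_mul hu)] at h1
      simp only [potentialEq, ← h1, hq]
      ring
  · intro t
    simp only [add_right_comm t P t₀, hΘP, Real.sin_add_two_pi, Real.cos_add_two_pi]
  · intro T' hT' hT'P hper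
    have h0 := hper 0
    simp only [zero_add, Prod.mk.injEq] at h0
    have hsin : Real.sin (Θ (T' + t₀)) = Real.sin (Θ t₀) := by
      have := congrArg (energyCoord h) h0.1
      rw [hC.coord_inv _ (Ioo_subset_Icc_self (hmem _)),
        hC.coord_inv _ (Ioo_subset_Icc_self (hmem _))] at this
      exact mul_left_cancel₀ hr.ne' this
    have hcos : Real.cos (Θ (T' + t₀)) = Real.cos (Θ t₀) := mul_left_cancel₀ hr.ne' h0.2
    obtain ⟨k, hk⟩ := Real.Angle.angle_eq_iff_two_pi_dvd_sub.1
      (Real.Angle.cos_sin_inj hcos hsin)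
    have hlt1 : Θ t₀ < Θ (T' + t₀) := hΘm (by linarith)
    have hlt2 : Θ (T' + t₀) < Θ t₀ + 2 * Real.pi := by
      rw [← hΘP]; exact hΘm (by linarith)
    have hk0 : (0 : ℝ) < k := pos_of_mul_pos_right (a := 2 * Real.pi) (by linarith)
      Real.two_pi_pos.le
    have hk1 : (k : ℝ) < 1 := by
      by_contra hge
      nlinarith [Real.two_pi_pos]
    have : 0 < k := by exact_mod_cast hk0
    have : k < 1 := by exact_mod_cast hk1
    omega

theorem integral_deriv_inv_add (hC : IsEnergyChart h a b c g) {r : ℝ} (hr : 0 < r) (hrc : r < c) :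
    ∫ θ in (0 : ℝ)..2 * Real.pi, (deriv g (r * Real.sin θ) + deriv g (-(r * Real.sin θ))) =
      2 * ∫ θ in (0 : ℝ)..2 * Real.pi, deriv g (r * Real.sin θ) := by
  have hc := hC.continuous_deriv_inv_mul_sin hr hrc
  have hc' : Continuous fun θ => deriv g (-(r * Real.sin θ)) := by
    have := hc.comp continuous_neg
    simpa [Function.comp_def] using this
  rw [intervalIntegral.integral_add (hc.intervalIntegrable _ _) (hc'.intervalIntegrable _ _),
    integral_comp_mul_sin_neg, ← two_mul]

theorem hasDerivAt_sub_inv_neg (hC : IsEnergyChart h a b c g) {u : ℝ} (hu : u ∈ Icc (-c) c) :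
    HasDerivAt (fun u => g u - g (-u)) (deriv g u + deriv g (-u)) u := by
  have hu' : -u ∈ Icc (-c) c := ⟨neg_le_neg hu.2, neg_le.1 hu.1⟩
  have h1 := (hC.analytic_inv u hu).differentiableAt.hasDerivAt
  have h2 := (hC.analytic_inv _ hu').differentiableAt.hasDerivAt.comp u (hasDerivAt_neg u)
  exact (h1.sub h2).congr_deriv (by ring)

/-- If the odd part of `g` is the identity, all orbits inside the energy level `c` have
period `2π`. -/
theorem isIsochronousCenter (hC : IsEnergyChart h a b c g) (h0 : h 0 = 0)
    (hodd : ∀ u ∈ Icc (-c) c, g u - g (-u) = 2 * u) :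
    IsIsochronousCenter (potentialEq h) (Icc a b) := by
  have hsum : ∀ u ∈ Ioo (-c) c, deriv g u + deriv g (-u) = 2 := fun u hu => by
    refine (hC.hasDerivAt_sub_inv_neg (Ioo_subset_Icc_self hu)).unique ?_
    have : HasDerivAt (fun u : ℝ => 2 * u) 2 u := by simpa using (hasDerivAt_id u).const_mul 2
    refine this.congr_of_eventuallyEq ?_
    filter_upwards [Icc_mem_nhds hu.1 hu.2] with y hy using hodd y hy
  have hP : ∀ r, 0 < r → r < c →
      ∫ θ in (0 : ℝ)..2 * Real.pi, deriv g (r * Real.sin θ) = 2 * Real.pi := fun r hr hrc => by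
    have h1 := hC.integral_deriv_inv_add hr hrc
    simp only [hsum _ (mul_sin_mem hr hrc _), intervalIntegral.integral_const, sub_zero,
      smul_eq_mul] at h1
    linarith
  refine ⟨by simp [potentialEq, h0], 2 * Real.pi,
    {p | p.1 ∈ Ioo a b ∧ energyCoord h p.1 ^ 2 + p.2 ^ 2 < c ^ 2}, ?_, ?_⟩
  · have hcont : ContinuousAt (fun p : ℝ × ℝ => energyCoord h p.1 ^ 2 + p.2 ^ 2) (0, 0) := by
      have : ContinuousAt (fun p : ℝ × ℝ => energyCoord h p.1) (0, 0) :=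
        ContinuousAt.comp (f := Prod.fst) (x := ((0 : ℝ), (0 : ℝ)))
          (hC.analytic 0 hC.zero_mem).continuousAt continuousAt_fst
      fun_prop
    refine (continuousAt_fst.eventually (Ioo_mem_nhds hC.neg hC.pos)).and
      (hcont.eventually (gt_mem_nhds ?_))
    simpa [energyCoord_zero] using pow_pos hC.c_pos 2
  · rintro ⟨x, v⟩ ⟨hx, hlt⟩ hne
    have hxI := Ioo_subset_Icc_self hx
    -- polar coordinates in the plane of `(v, s(x))`
    set z : ℂ := ⟨v, energyCoord h x⟩
    have hz0 : z ≠ 0 := fun hz => hne <| by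
      have h1 : energyCoord h x = 0 := congrArg Complex.im hz
      have h2 : v = 0 := congrArg Complex.re hz
      have h3 := hC.inv_coord x hxI
      rw [h1, hC.inv_zero] at h3
      rw [← h3, h2]
    have hzc : ‖z‖ < c := by
      refine lt_of_pow_lt_pow_left₀ 2 hC.c_pos.le ?_
      rw [Complex.sq_norm, Complex.normSq_apply]
      simp only [z]
      nlinarith
    obtain ⟨y, w, hy, hw, hsol, hper⟩ := hC.exists_orbit (norm_pos_iff.2 hz0) hzc z.arg
    rw [hP _ (norm_pos_iff.2 hz0) hzc] at hper
    refine ⟨y, w, ?_, ?_, hsol, hper⟩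
    · rw [hy, Complex.norm_mul_sin_arg]
      exact hC.inv_coord x hxI
    · rw [hw, Complex.norm_mul_cos_arg]

/-- The curves of `exists_orbit` are the only solutions, so isochronicity makes their periods
independent of the amplitude. -/
theorem exists_period_eq (hC : IsEnergyChart h a b c g) (han : AnalyticOnNhd ℝ h (Icc a b))
    (hiso : IsIsochronousCenter (potentialEq h) (Icc a b)) :
    ∃ T ρ : ℝ, 0 < ρ ∧ ρ ≤ c ∧ ∀ r ∈ Ioo 0 ρ,
      ∫ θ in (0 : ℝ)..2 * Real.pi, deriv g (r * Real.sin θ) = T := by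
  obtain ⟨-, T, U, hU, hall⟩ := hiso
  have hcont : ContinuousAt (fun r : ℝ => ((0 : ℝ), r)) 0 := by fun_prop
  obtain ⟨ε, hε, hεU⟩ := Metric.eventually_nhds_iff.1 (hcont.eventually hU)
  refine ⟨T, min ε c, lt_min hε hC.c_pos, min_le_right _ _, fun r hr => ?_⟩
  obtain ⟨hrε, hrc⟩ := lt_min_iff.1 hr.2
  have hrU : ((0 : ℝ), r) ∈ U := hεU (by simpa [Real.dist_eq, abs_of_pos hr.1] using hrε)
  obtain ⟨x, v, hx, hv, hsol, hper⟩ := hall _ hrU (by simp [hr.1.ne'])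
  obtain ⟨x', v', hx', hv', hsol', hper'⟩ := hC.exists_orbit hr.1 hrc 0
  obtain ⟨rfl, rfl⟩ := solvesOn_potentialEq_unique han hsol hsol'
    (by simp [hx, hx', hC.inv_zero]) (by simp [hv, hv'])
  exact hper'.unique hper

/-- If the period does not depend on the energy and `h'(0) = 1`, the odd part of `g` is the
identity: the function `g'(u) + g'(-u) - T / π` is even with zero means over all small circles. -/
theorem sub_inv_neg_of_isIsochronousCenter (hC : IsEnergyChart h a b c g)
    (han : AnalyticOnNhd ℝ h (Icc a b)) (h1 : deriv h 0 = 1)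
    (hiso : IsIsochronousCenter (potentialEq h) (Icc a b)) :
    ∀ u ∈ Icc (-c) c, g u - g (-u) = 2 * u := by
  obtain ⟨T, ρ, hρ, hρc, hT⟩ := hC.exists_period_eq han hiso
  have h0c : (0 : ℝ) ∈ Ioo (-c) c := ⟨neg_lt_zero.2 hC.c_pos, hC.c_pos⟩
  have hneg : ∀ {u}, u ∈ Icc (-c) c → -u ∈ Icc (-c) c := fun {u} hu =>
    ⟨neg_le_neg hu.2, neg_le.1 hu.1⟩
  have hsan : ∀ k : ℝ, AnalyticOnNhd ℝ (fun u => deriv g u + deriv g (-u) - k) (Icc (-c) c) :=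
    fun k u hu => by
      have h2 : AnalyticAt ℝ (fun u => deriv g (-u)) u :=
        AnalyticAt.fun_comp (f := fun u : ℝ => -u) (hC.analytic_inv _ (hneg hu)).deriv (by fun_prop)
      exact ((hC.analytic_inv u hu).deriv.fun_add h2).fun_sub analyticAt_const
  have hev : ∀ᶠ u in 𝓝 0, deriv g u + deriv g (-u) - T / Real.pi = 0 := by
    refine (hsan (T / Real.pi) 0 (Ioo_subset_Icc_self h0c)).eventually_eq_zero_of_integral_mul_sin
      (fun u => by rw [neg_neg]; ring) hρ fun r hr => ?_
    have hrc : r < c := hr.2.trans_le hρc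
    have hc := hC.continuous_deriv_inv_mul_sin hr.1 hrc
    have hc' : Continuous fun θ => deriv g (-(r * Real.sin θ)) := by
      simpa [Function.comp_def] using hc.comp continuous_neg
    rw [intervalIntegral.integral_sub ((hc.fun_add hc').intervalIntegrable _ _)
      intervalIntegrable_const, hC.integral_deriv_inv_add hr.1 hrc, hT r hr,
      intervalIntegral.integral_const, smul_eq_mul]
    field_simp [Real.pi_ne_zero]
    ring
  have hg0 : deriv g 0 = 1 := by
    have h2 := hC.deriv_inv_mul h0c
    have h3 := hC.sq_deriv_zero
    rw [hC.inv_zero] at h2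
    rw [h1] at h3
    rwa [(pow_eq_one_iff_of_nonneg (hC.deriv_pos 0 hC.zero_mem).le two_ne_zero).1 h3, one_mul] at h2
  have hT2 : T / Real.pi = 2 := by
    have := hev.self_of_nhds
    rw [neg_zero, hg0] at this
    linarith
  rw [hT2] at hev
  have hzero := (hsan 2).eqOn_zero_of_preconnected_of_eventuallyEq_zero isPreconnected_Icc
    (Ioo_subset_Icc_self h0c) hev
  have hk : ∀ u ∈ Icc (-c) c, HasDerivAt (fun u => g u - g (-u) - 2 * u) 0 u := fun u hu => by
    refine ((hC.hasDerivAt_sub_inv_neg hu).fun_sub ((hasDerivAt_id u).const_mul 2)).congr_deriv ?_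
    have := hzero hu
    simpa using this
  have hconst := constant_of_derivWithin_zero (f := fun u => g u - g (-u) - 2 * u)
    (fun u hu => (hk u hu).differentiableAt.differentiableWithinAt)
    (fun u hu => by
      have hu' := Ico_subset_Icc_self hu
      exact (hk u hu').hasDerivWithinAt.derivWithin
        (uniqueDiffOn_Icc (by linarith [hC.c_pos]) u hu'))
  intro u hu
  have h2 := hconst u hu
  have h3 := hconst 0 (Ioo_subset_Icc_self h0c)
  simp only [neg_zero, sub_self, mul_zero] at h2 h3
  linarith

end IsEnergyChart

/-! ### Conjugation by an involution of the interval -/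

theorem HasMinimalPeriod.of_map {x v x' v' : ℝ → ℝ} {T : ℝ} (h : HasMinimalPeriod x v T)
    {φ ψ : ℝ × ℝ → ℝ × ℝ} (hφ : ∀ t, φ (x t, v t) = (x' t, v' t))
    (hψ : ∀ t, ψ (x' t, v' t) = (x t, v t)) : HasMinimalPeriod x' v' T := by
  refine ⟨h.1, fun t => ?_, fun T' h0 hT hper => h.2.2 T' h0 hT fun t => ?_⟩
  · have := h.2.1 t
    simp only at this ⊢
    rw [← hφ, ← hφ, this]
  · have := hper t
    simp only at this ⊢
    rw [← hψ, ← hψ, this]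

section Conjugation

variable {h A : ℝ → ℝ} {a b : ℝ} {J : Set ℝ} {y v : ℝ → ℝ}

theorem hasDerivAt_comp_of_mapsTo {f : ℝ → ℝ} (hf : DifferentiableOn ℝ f (Icc a b))
    (hJ : IsOpen J) (hy : MapsTo y J (Icc a b)) {t d : ℝ} (ht : t ∈ J) (hd : HasDerivAt y d t) :
    HasDerivAt (fun t => f (y t)) (derivWithin f (Icc a b) (y t) * d) t :=
  (hf _ (hy ht)).hasDerivWithinAt.comp_hasDerivAt t hd
    (eventually_of_mem (hJ.mem_nhds ht) fun _ hs => hy hs)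

theorem hasDerivAt_derivWithin_comp_mul
    (hA' : DifferentiableOn ℝ (derivWithin A (Icc a b)) (Icc a b))
    (hJ : IsOpen J) (hy : MapsTo y J (Icc a b)) {t w : ℝ} (ht : t ∈ J)
    (hd : HasDerivAt y (v t) t) (hw : HasDerivAt v w t) :
    HasDerivAt (fun t => derivWithin A (Icc a b) (y t) * v t)
      (derivWithin (derivWithin A (Icc a b)) (Icc a b) (y t) * v t ^ 2
        + derivWithin A (Icc a b) (y t) * w) t :=
  ((hasDerivAt_comp_of_mapsTo hA' hJ hy ht hd).fun_mul hw).congr_deriv (by ring)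

theorem SolvesOn.potentialEq_of_transformedEq (hmaps : MapsTo A (Icc a b) (Icc a b))
    (hA : DifferentiableOn ℝ A (Icc a b))
    (hA' : DifferentiableOn ℝ (derivWithin A (Icc a b)) (Icc a b)) (hJ : IsOpen J)
    (hsol : SolvesOn (transformedEq h A a b) (Icc a b) J y v) :
    SolvesOn (potentialEq h) (Icc a b) J (fun t => A (y t))
      (fun t => derivWithin A (Icc a b) (y t) * v t) := by
  have hy : MapsTo y J (Icc a b) := fun t ht => (hsol t ht).1
  intro t ht
  obtain ⟨hm, hd, w, hw, hE⟩ := hsol t ht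
  exact ⟨hmaps hm, hasDerivAt_comp_of_mapsTo hA hJ hy ht hd, _,
    hasDerivAt_derivWithin_comp_mul hA' hJ hy ht hd hw, hE⟩

theorem SolvesOn.transformedEq_of_potentialEq (hinv : ∀ x ∈ Icc a b, A (A x) = x)
    (hA : DifferentiableOn ℝ A (Icc a b))
    (hA' : DifferentiableOn ℝ (derivWithin A (Icc a b)) (Icc a b)) (hJ : IsOpen J)
    (hy : MapsTo y J (Icc a b))
    (hsol : SolvesOn (potentialEq h) (Icc a b) J (fun t => A (y t)) v) :
    SolvesOn (transformedEq h A a b) (Icc a b) J y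
      (fun t => derivWithin A (Icc a b) (A (y t)) * v t) := by
  have hx : MapsTo (fun t => A (y t)) J (Icc a b) := fun t ht => (hsol t ht).1
  have hyd : ∀ t ∈ J, HasDerivAt y (derivWithin A (Icc a b) (A (y t)) * v t) t := fun t ht => by
    refine (hasDerivAt_comp_of_mapsTo hA hJ hx ht (hsol t ht).2.1).congr_of_eventuallyEq ?_
    filter_upwards [hJ.mem_nhds ht] with s hs using (hinv _ (hy hs)).symm
  intro t ht
  obtain ⟨hm, hd, w, hw, hE⟩ := hsol t ht
  have hvd := hasDerivAt_derivWithin_comp_mul hA' hJ hx ht hd hw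
  refine ⟨hy ht, hyd t ht, _, hvd, ?_⟩
  -- both expressions for `x''` agree by uniqueness of derivatives
  have hx2 := hasDerivAt_derivWithin_comp_mul hA' hJ hy ht (hyd t ht) hvd
  have heq : w = _ := hw.unique (hx2.congr_of_eventuallyEq (by
    filter_upwards [hJ.mem_nhds ht] with s hs
    exact (hsol s hs).2.1.unique (hasDerivAt_comp_of_mapsTo hA hJ hy hs (hyd s hs))))
  rw [potentialEq, heq] at hE
  exact hE

/-- An isochronous center is carried over by the phase plane involution
`(x, v) ↦ (A(x), A'(x) v)`, provided that it maps solutions to solutions. -/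
theorem IsIsochronousCenter.of_conj {E E' : ℝ → ℝ → ℝ → ℝ} (ha : a < 0) (hb : 0 < b)
    (hmaps : MapsTo A (Icc a b) (Icc a b)) (hinv : ∀ x ∈ Icc a b, A (A x) = x) (hA0 : A 0 = 0)
    (hA : DifferentiableOn ℝ A (Icc a b))
    (hA' : DifferentiableOn ℝ (derivWithin A (Icc a b)) (Icc a b)) (hE' : E' 0 0 0 = 0)
    (hsol : ∀ x v, SolvesOn E (Icc a b) univ x v →
      SolvesOn E' (Icc a b) univ (fun t => A (x t)) (fun t => derivWithin A (Icc a b) (x t) * v t))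
    (hiso : IsIsochronousCenter E (Icc a b)) : IsIsochronousCenter E' (Icc a b) := by
  set D := derivWithin A (Icc a b)
  have hDD : ∀ x ∈ Icc a b, D (A x) * D x = 1 := fun x hx => by
    have h1 : HasDerivWithinAt (fun x => A (A x)) (D (A x) * D x) (Icc a b) x :=
      (hA _ (hmaps hx)).hasDerivWithinAt.comp x (hA x hx).hasDerivWithinAt hmaps
    exact (uniqueDiffOn_Icc (ha.trans hb) x hx).eq_deriv _ h1
      ((hasDerivWithinAt_id x _).congr hinv (hinv x hx))
  set Φ : ℝ × ℝ → ℝ × ℝ := fun p => (A p.1, D p.1 * p.2)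
  have hΦΦ : ∀ p : ℝ × ℝ, p.1 ∈ Icc a b → Φ (Φ p) = p := fun p hp => by
    simp only [Φ, hinv p.1 hp, ← mul_assoc, hDD p.1 hp, one_mul]
  have hΦ0 : Φ (0, 0) = (0, 0) := by simp [Φ, hA0]
  have hI : Icc a b ∈ 𝓝 (0 : ℝ) := Icc_mem_nhds ha hb
  have h0 : (0 : ℝ) ∈ Icc a b := mem_of_mem_nhds hI
  have hΦc : ContinuousAt Φ (0, 0) := by
    have hc : ∀ {f : ℝ → ℝ}, DifferentiableOn ℝ f (Icc a b) →
        ContinuousAt (fun p : ℝ × ℝ => f p.1) (0, 0) := fun {f} hf =>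
      ContinuousAt.comp (f := Prod.fst) (x := ((0 : ℝ), (0 : ℝ)))
        ((hf 0 h0).continuousWithinAt.continuousAt hI) continuousAt_fst
    exact (hc hA).prodMk ((hc hA').mul continuousAt_snd)
  obtain ⟨-, T, U, hU, hall⟩ := hiso
  refine ⟨hE', T, {p | p.1 ∈ Icc a b ∧ Φ p ∈ U}, ?_, ?_⟩
  · have hfst : ∀ᶠ p in 𝓝 ((0 : ℝ), (0 : ℝ)), p.1 ∈ Icc a b :=
      continuousAt_fst.preimage_mem_nhds hI
    exact hfst.and (hΦc.eventually (by rwa [hΦ0]))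
  · rintro p ⟨hp, hpU⟩ hp0
    obtain ⟨x, v, hx, hv, hs, hper⟩ := hall (Φ p) hpU fun hz => hp0 <| by
      rw [← hΦΦ p hp, hz, hΦ0]
    have hinit : Φ (x 0, v 0) = p := by rw [hx, hv, Prod.mk.eta, hΦΦ p hp]
    exact ⟨_, _, congrArg Prod.fst hinit, congrArg Prod.snd hinit, hsol x v hs,
      hper.of_map (φ := Φ) (ψ := Φ) (fun _ => rfl) fun t => hΦΦ (x t, v t) (hs t (mem_univ t)).1⟩

end Conjugation

/-! ### The energy involution -/

namespace IsEnergyChart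

variable {h : ℝ → ℝ} {a b c : ℝ} {g A : ℝ → ℝ}

theorem neg_coord_mem (hC : IsEnergyChart h a b c g) {x : ℝ} (hx : x ∈ Icc a b) :
    -energyCoord h x ∈ Icc (-c) c :=
  have hs := hC.coord_mem hx
  ⟨neg_le_neg hs.2, neg_le.1 hs.1⟩

theorem coord_pos (hC : IsEnergyChart h a b c g) {x : ℝ} (hx : x ∈ Icc a b) :
    0 < energyCoord h x ↔ 0 < x := by
  rw [← energyCoord_zero h, hC.strictMono.lt_iff_lt hC.zero_mem hx, energyCoord_zero]

theorem coord_neg (hC : IsEnergyChart h a b c g) {x : ℝ} (hx : x ∈ Icc a b) :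
    energyCoord h x < 0 ↔ x < 0 := by
  rw [← energyCoord_zero h, hC.strictMono.lt_iff_lt hx hC.zero_mem, energyCoord_zero]

/-- In the energy coordinate the involution is the reflection in `0`. -/
theorem isEnergyInvolution (hC : IsEnergyChart h a b c g) :
    IsEnergyInvolution h a b fun x => g (-energyCoord h x) where
  mapsTo x hx := hC.inv_mem _ (hC.neg_coord_mem hx)
  potential_eq x hx := by
    have h1 := hC.sq_eq _ (hC.inv_mem _ (hC.neg_coord_mem hx))
    rw [hC.coord_inv _ (hC.neg_coord_mem hx), neg_sq, hC.sq_eq x hx] at h1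
    linarith
  mul_neg x hx hx0 := by
    have hm := hC.neg_coord_mem hx
    have hi := hC.inv_mem _ hm
    rcases lt_or_gt_of_ne hx0 with h' | h'
    · refine mul_neg_of_pos_of_neg ((hC.coord_pos hi).1 ?_) h'
      rw [hC.coord_inv _ hm, neg_pos]
      exact (hC.coord_neg hx).2 h'
    · refine mul_neg_of_neg_of_pos ((hC.coord_neg hi).1 ?_) h'
      rw [hC.coord_inv _ hm, neg_lt_zero]
      exact (hC.coord_pos hx).2 h'

theorem coord_involution (hC : IsEnergyChart h a b c g) (hA : IsEnergyInvolution h a b A) {x : ℝ}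
    (hx : x ∈ Icc a b) : energyCoord h (A x) = -energyCoord h x := by
  have hsq : energyCoord h (A x) ^ 2 = energyCoord h x ^ 2 := by
    rw [hC.sq_eq _ (hA.mapsTo hx), hC.sq_eq x hx, hA.potential_eq x hx]
  rcases sq_eq_sq_iff_eq_or_eq_neg.1 hsq with heq | heq
  · have hAx : A x = x := hC.strictMono.injOn (hA.mapsTo hx) hx heq
    have hx0 : x = 0 := by
      by_contra hne
      have := hA.mul_neg x hx hne
      rw [hAx] at this
      exact absurd this (mul_self_nonneg x).not_gt
    rw [hAx, hx0, energyCoord_zero, neg_zero]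
  · exact heq

theorem involution_eq (hC : IsEnergyChart h a b c g) (hA : IsEnergyInvolution h a b A) :
    EqOn A (fun x => g (-energyCoord h x)) (Icc a b) := fun x hx => by
  simp only [← hC.coord_involution hA hx, hC.inv_coord _ (hA.mapsTo hx)]

theorem involution_involution (hC : IsEnergyChart h a b c g) (hA : IsEnergyInvolution h a b A)
    {x : ℝ} (hx : x ∈ Icc a b) : A (A x) = x := by
  refine hC.strictMono.injOn (hA.mapsTo (hA.mapsTo hx)) hx ?_
  rw [hC.coord_involution hA (hA.mapsTo hx), hC.coord_involution hA hx, neg_neg]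

theorem involution_zero (hC : IsEnergyChart h a b c g) (hA : IsEnergyInvolution h a b A) :
    A 0 = 0 := by
  rw [hC.involution_eq hA hC.zero_mem]
  simp [energyCoord_zero, hC.inv_zero]

theorem uniqueDiffOn (hC : IsEnergyChart h a b c g) : UniqueDiffOn ℝ (Icc a b) :=
  uniqueDiffOn_Icc (hC.neg.trans hC.pos)

theorem analyticOnNhd_inv_neg_coord (hC : IsEnergyChart h a b c g) :
    AnalyticOnNhd ℝ (fun x => g (-energyCoord h x)) (Icc a b) := fun x hx =>
  AnalyticAt.fun_comp (f := fun x => -energyCoord h x) (hC.analytic_inv _ (hC.neg_coord_mem hx))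
    (hC.analytic x hx).fun_neg

theorem analyticOn_involution (hC : IsEnergyChart h a b c g) (hA : IsEnergyInvolution h a b A) :
    AnalyticOn ℝ A (Icc a b) :=
  hC.analyticOnNhd_inv_neg_coord.analyticOn.congr (hC.involution_eq hA)

theorem differentiableOn_derivWithin_involution (hC : IsEnergyChart h a b c g)
    (hA : IsEnergyInvolution h a b A) :
    DifferentiableOn ℝ (derivWithin A (Icc a b)) (Icc a b) := by
  refine hC.analyticOnNhd_inv_neg_coord.deriv.differentiableOn.congr fun x hx => ?_
  rw [derivWithin_congr (hC.involution_eq hA) (hC.involution_eq hA hx)]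
  exact (hC.analyticOnNhd_inv_neg_coord x hx).differentiableAt.derivWithin (hC.uniqueDiffOn x hx)

theorem derivWithin_involution_neg (hC : IsEnergyChart h a b c g)
    (hA : IsEnergyInvolution h a b A) {x : ℝ} (hx : x ∈ Icc a b) :
    derivWithin A (Icc a b) x < 0 := by
  have h1 : HasDerivWithinAt (fun x => energyCoord h (A x))
      (deriv (energyCoord h) (A x) * derivWithin A (Icc a b) x) (Icc a b) x :=
    (hC.analytic _ (hA.mapsTo hx)).differentiableAt.hasDerivAt.comp_hasDerivWithinAt x
      ((hC.analyticOn_involution hA).differentiableOn x hx).hasDerivWithinAt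
  have h2 : HasDerivWithinAt (fun x => -energyCoord h x) (-deriv (energyCoord h) x) (Icc a b) x :=
    (hC.analytic x hx).differentiableAt.hasDerivAt.neg.hasDerivWithinAt
  have h3 := (hC.uniqueDiffOn x hx).eq_deriv _ h1
    (h2.congr (fun y hy => hC.coord_involution hA hy) (hC.coord_involution hA hx))
  have hp := hC.deriv_pos _ (hA.mapsTo hx)
  have hq := hC.deriv_pos x hx
  refine neg_of_mul_neg_right (a := deriv (energyCoord h) (A x)) ?_ hp.le
  rw [h3]
  exact neg_lt_zero.2 hq

/-! ### The conditions on the involution -/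

theorem involution_eq_sub_iff (hC : IsEnergyChart h a b c g) (hA : IsEnergyInvolution h a b A) :
    (∀ x ∈ Icc a b, A x = x - 2 * energyCoord h x) ↔
      ∀ u ∈ Icc (-c) c, g u - g (-u) = 2 * u := by
  constructor
  · intro h4 u hu
    have h1 := h4 _ (hC.inv_mem u hu)
    simp only [hC.involution_eq hA (hC.inv_mem u hu), hC.coord_inv u hu] at h1
    linarith
  · intro hodd x hx
    have h1 := hodd _ (hC.coord_mem hx)
    rw [hC.inv_coord x hx] at h1
    simp only [hC.involution_eq hA hx]
    linarith

/-- Both conditions say that the energy coordinate is `(x - A(x)) / 2`; the first one is the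
derivative of `H(x) = (x - A(x))² / 8`. -/
theorem eq_mul_one_sub_derivWithin_iff (hC : IsEnergyChart h a b c g)
    (hd : ∀ x ∈ Icc a b, HasDerivAt (potential h) (h x) x) (hA : IsEnergyInvolution h a b A) :
    (∀ x ∈ Icc a b, h x = 1 / 4 * (x - A x) * (1 - derivWithin A (Icc a b) x)) ↔
      ∀ x ∈ Icc a b, A x = x - 2 * energyCoord h x := by
  have hAd : ∀ x ∈ Icc a b,
      HasDerivWithinAt A (derivWithin A (Icc a b) x) (Icc a b) x := fun x hx =>
    ((hC.analyticOn_involution hA).differentiableOn x hx).hasDerivWithinAt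
  constructor
  · intro h3
    have hk : ∀ x ∈ Icc a b, HasDerivWithinAt (fun x => potential h x - (x - A x) ^ 2 / 8) 0
        (Icc a b) x := fun x hx => by
      have h1 := ((((hasDerivWithinAt_id x (Icc a b)).fun_sub (hAd x hx)).fun_pow 2).div_const 8)
      refine ((hd x hx).hasDerivWithinAt.fun_sub h1).congr_deriv ?_
      rw [h3 x hx]
      simp
      ring
    have hconst := constant_of_derivWithin_zero
      (fun x hx => (hk x hx).differentiableWithinAt)
      (fun x hx => (hk x (Ico_subset_Icc_self hx)).derivWithin
        (hC.uniqueDiffOn x (Ico_subset_Icc_self hx)))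
    have hH : ∀ x ∈ Icc a b, potential h x = (x - A x) ^ 2 / 8 := fun x hx => by
      have h1 := hconst x hx
      have h2 := hconst 0 hC.zero_mem
      simp only [potential_zero, hC.involution_zero hA, sub_self] at h1 h2
      linarith
    intro x hx
    have hsq : energyCoord h x ^ 2 = ((x - A x) / 2) ^ 2 := by
      rw [hC.sq_eq x hx, hH x hx]; ring
    rcases lt_trichotomy x 0 with h' | h' | h'
    · have hAx : 0 < A x := pos_of_mul_neg_left (hA.mul_neg x hx h'.ne) h'.le
      have hs := (hC.coord_neg hx).2 h'
      rcases sq_eq_sq_iff_eq_or_eq_neg.1 hsq with heq | heq <;> linarith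
    · rw [h', hC.involution_zero hA, energyCoord_zero]; ring
    · have hAx : A x < 0 := neg_of_mul_neg_left (hA.mul_neg x hx h'.ne') h'.le
      have hs := (hC.coord_pos hx).2 h'
      rcases sq_eq_sq_iff_eq_or_eq_neg.1 hsq with heq | heq <;> linarith
  · intro h4 x hx
    have h1 : HasDerivWithinAt (fun x => x - 2 * energyCoord h x)
        (1 - 2 * deriv (energyCoord h) x) (Icc a b) x :=
      (hasDerivWithinAt_id x _).fun_sub
        (((hC.analytic x hx).differentiableAt.hasDerivAt.const_mul 2).hasDerivWithinAt)
    have h2 := (hC.uniqueDiffOn x hx).eq_deriv _ (hAd x hx) (h1.congr h4 (h4 x hx))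
    rw [h2, h4 x hx, ← hC.mul_deriv x hx]
    ring

end IsEnergyChart

theorem proposition9 (h : ℝ → ℝ) (a b : ℝ) (ha : a < 0) (hb : 0 < b)
    (han : AnalyticOnNhd ℝ h (Icc a b))
    (h0 : h 0 = 0) (h1 : 0 < deriv h 0)
    (hpos : ∀ x ∈ Icc a b, x ≠ 0 → 0 < x * h x)
    (hab : potential h a = potential h b) :
    -- the involution exists and is unique on `[a, b]`
    (∃ A : ℝ → ℝ, IsEnergyInvolution h a b A ∧
      ∀ B : ℝ → ℝ, IsEnergyInvolution h a b B → EqOn B A (Icc a b)) ∧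
    ∀ A : ℝ → ℝ, IsEnergyInvolution h a b A →
      -- it is an analytic decreasing involution fixing `0`, and the potential is invariant
      AnalyticOn ℝ A (Icc a b) ∧ A 0 = 0 ∧
      (∀ x ∈ Icc a b, A (A x) = x) ∧
      (∀ x ∈ Icc a b, derivWithin A (Icc a b) x < 0) ∧
      (∀ x ∈ Icc a b, potential h (A x) = potential h x) ∧
      -- `x = A(y)` carries one equation into the other
      (∀ J : Set ℝ, IsOpen J → ∀ y : ℝ → ℝ, MapsTo y J (Icc a b) →
        ((∃ v, SolvesOn (transformedEq h A a b) (Icc a b) J y v) ↔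
          ∃ v, SolvesOn (potentialEq h) (Icc a b) J (fun t => A (y t)) v)) ∧
      -- the part of the equivalences that does not need the normalization `h'(0) = 1`
      (IsIsochronousCenter (potentialEq h) (Icc a b) ↔
        IsIsochronousCenter (transformedEq h A a b) (Icc a b)) ∧
      ((∀ x ∈ Icc a b, h x = 1 / 4 * (x - A x) * (1 - derivWithin A (Icc a b) x)) ↔
        ∀ x ∈ Icc a b, A x = x - 2 * (Real.sign x * √(2 * potential h x))) ∧
      ((∀ x ∈ Icc a b, h x = 1 / 4 * (x - A x) * (1 - derivWithin A (Icc a b) x)) →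
        IsIsochronousCenter (potentialEq h) (Icc a b)) ∧
      -- all four conditions are equivalent
      (deriv h 0 = 1 →
        List.TFAE [
          IsIsochronousCenter (potentialEq h) (Icc a b),
          IsIsochronousCenter (transformedEq h A a b) (Icc a b),
          ∀ x ∈ Icc a b, h x = 1 / 4 * (x - A x) * (1 - derivWithin A (Icc a b) x),
          ∀ x ∈ Icc a b, A x = x - 2 * (Real.sign x * √(2 * potential h x))]) := by
  obtain ⟨c, g, hC⟩ := exists_isEnergyChart ha hb han h0 h1 hpos hab
  refine ⟨⟨_, hC.isEnergyInvolution, fun B hB => hC.involution_eq hB⟩, fun A hA => ?_⟩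
  have hdiff : DifferentiableOn ℝ A (Icc a b) := (hC.analyticOn_involution hA).differentiableOn
  have hdiff' := hC.differentiableOn_derivWithin_involution hA
  have hinv : ∀ x ∈ Icc a b, A (A x) = x := fun x hx => hC.involution_involution hA hx
  have hA0 := hC.involution_zero hA
  have h12 : IsIsochronousCenter (potentialEq h) (Icc a b) ↔
      IsIsochronousCenter (transformedEq h A a b) (Icc a b) := by
    refine ⟨.of_conj ha hb hA.mapsTo hinv hA0 hdiff hdiff' (by simp [transformedEq, hA0, h0])
      fun x v hs => ?_, .of_conj ha hb hA.mapsTo hinv hA0 hdiff hdiff' (by simp [potentialEq, h0])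
      fun y v hs => hs.potentialEq_of_transformedEq hA.mapsTo hdiff hdiff' isOpen_univ⟩
    -- `x` is itself the image of `A ∘ x` under `A`
    have hx : (fun t => A (A (x t))) = x := funext fun t => hinv _ (hs t (mem_univ t)).1
    have hmaps : MapsTo (fun t => A (x t)) univ (Icc a b) := fun t ht => hA.mapsTo (hs t ht).1
    have := SolvesOn.transformedEq_of_potentialEq (v := v) hinv hdiff hdiff' isOpen_univ hmaps
      (by rwa [hx])
    simpa only [congrFun hx] using this
  have h34 := hC.eq_mul_one_sub_derivWithin_iff
    (fun x hx => (hasDerivAt_potential ha hb han hx).self_of_nhds) hA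
  have h4 := hC.involution_eq_sub_iff hA
  have h31 : (∀ x ∈ Icc a b, h x = 1 / 4 * (x - A x) * (1 - derivWithin A (Icc a b) x)) →
      IsIsochronousCenter (potentialEq h) (Icc a b) := fun h3 =>
    hC.isIsochronousCenter h0 (h4.1 (h34.1 h3))
  refine ⟨hC.analyticOn_involution hA, hA0, hinv, fun x hx => hC.derivWithin_involution_neg hA hx,
    hA.potential_eq, fun J hJ y hy => ⟨?_, ?_⟩, h12, h34, h31, fun hd => ?_⟩
  · rintro ⟨v, hv⟩
    exact ⟨_, hv.potentialEq_of_transformedEq hA.mapsTo hdiff hdiff' hJ⟩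
  · rintro ⟨v, hv⟩
    exact ⟨_, hv.transformedEq_of_potentialEq hinv hdiff hdiff' hJ hy⟩
  · tfae_have 1 ↔ 2 := h12
    tfae_have 3 ↔ 4 := h34
    tfae_have 3 → 1 := h31
    tfae_have 1 → 4 := fun hiso =>
      h4.2 (hC.sub_inv_neg_of_isIsochronousCenter han hd hiso)
    tfae_finish
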